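/- Let $G$ be a noncompact connected real semisimple Lie group with finite centre, let $K$ be a maximal compact subgroup, $dk$ its normalised Haar measure, and let $\theta$ be the Cartan involution of the Lie algebra $\mathfrak g$ of $G$ whose fixed algebra is the Lie algebra of $K$. Let $\mathfrak a$ be a maximal commutative subspace of the $-1$ eigenspace of $\theta$, fix a Weyl chamber in $\mathfrak a$, let $\mathfrak n$ be the sum of the root spaces $\mathfrak g_\alpha$ of the positive restricted roots, let $N$ be the connected subgroup of $G$ with Lie algebra $\mathfrak n$, put $\rho=\frac12\sum_{\alpha>0}\dim(\mathfrak g_\alpha)\,\alpha\in\mathfrak a^*$, and define $H(x)\in\mathfrak a$ by the Iwasawa decomposition $x\in K\exp(H(x))N$. For $\lambda\in\mathfrak a^*=\operatorname{Hom}(\mathfrak a,\mathbb R)$ let $\phi_\lambda$ be the spherical function $$\phi_\lambda(x)=\int_K e^{-(\lambda+\rho)(H(x^{-1}k))}\,dk ,\qquad x\in G .$$ For a continuous function $u$ on $G$ put $$\mathcal A u(x)=\Bigl(\int_K\int_K|u(kxk')|^2\,dk\,dk'\Bigr)^{1/2},\qquad x\in G.$$ A unitary representation $\sigma$ of $G$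 (continuous, on a Hilbert space $\mathcal H_\sigma$) is weakly contained in a unitary representation $\pi$ if every function $\langle\sigma(\cdot)\xi,\xi\rangle$ with $\xi\in\mathcal H_\sigma$ is a limit, uniformly on compact subsets of $G$, of finite sums $\sum_j\langle\pi(\cdot)\xi_j,\xi_j\rangle$ with $\xi_j\in\mathcal H_\pi$. **Theorem A.** Let $\pi$ be a unitary representation of $G$ and let $\lambda\in\mathfrak a^*$. Consider the condition $$\mathcal A\langle\pi(\cdot)\xi,\eta\rangle(x)\le\|\xi\|\,\|\eta\|\,\phi_\lambda(x)\qquad\text{for all }\xi,\eta\in\mathcal H_\pi\text{ and all }x\in G.\tag{$*$}$$ Then $(*)$ holds for $\pi$ if and only if every unitary representation $\sigma$ of $G$ that is weakly contained in $\pi$ satisfies $(*)$ with $\pi$ replaced by $\sigma$. In particular, $(*)$ passes to the irreducible constituents of $\pi$: if $(*)$ holds for $\pi$ and $\pi$ is unitarily equivalent to a direct integral $\int_X^{\oplus}\sigma_x\,d\mu(x)$ of a measurable field of irreducible unitary representations of $G$ over a $\sigma$-finite measure space $(X,\mu)$, then $\sigma_x$ satisfies $(*)$ for $\mu$-almost every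 $x\in X$. -/

import Mathlib

open MeasureTheory Manifold ContDiff

universe u v w

/-- Over the reals, smooth Lie groups have the (finite) order of differentiability that Mathlib
requires for the Lie bracket on the tangent space at the identity. -/
instance instLEInftyMinSmoothnessReal : ENat.LEInfty (minSmoothness ℝ 3) where
  out := by
    rw [minSmoothness_of_isRCLikeNormedField]
    exact ENat.LEInfty.out

/-! ### Semisimple Lie groups: exponential map, Cartan and Iwasawa data, spherical functions -/

section LieGroups

variable {d : ℕ} {G : Type u} [TopologicalSpace G] [ChartedSpace (EuclideanSpace ℝ (Fin d)) G]
  [Group G]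

/-- The exponential map of a Lie group: `exp X = γ 1`, where `γ` is the integral curve through `1`
of the left-invariant vector field determined by `X` (which exists and is unique). -/
noncomputable def lieExp (X : GroupLieAlgebra (𝓡 d) G) : G :=
  open Classical in
  if h : ∃ γ : ℝ → G, γ 0 = 1 ∧
      IsMIntegralCurve γ (fun g : G => mulInvariantVectorField (I := 𝓡 d) X g) then
    h.choose 1
  else 1

variable [LieGroup (𝓡 d) ∞ G]

variable (d G) in
/-- A Cartan involution of the Lie algebra of `G`: an involutive Lie algebra automorphism `θ` such
that `(X, Y) ↦ -B(X, θ Y)` is positive definite, `B` being the Killing form. -/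
structure IsCartanInvolution
    (θ : GroupLieAlgebra (𝓡 d) G ≃ₗ⁅ℝ⁆ GroupLieAlgebra (𝓡 d) G) : Prop where
  involutive : ∀ X, θ (θ X) = X
  pos_def : ∀ X, X ≠ 0 → 0 < -(killingForm ℝ (GroupLieAlgebra (𝓡 d) G) X (θ X))

variable (d G) in
/-- The choices that enter the definition of the spherical functions of a semisimple Lie group:
a maximal compact subgroup `K`, the Cartan involution `θ` whose fixed algebra is the Lie algebra
of `K`, a maximal commutative subspace `𝔞` of the `-1` eigenspace `𝔭` of `θ`, and a Weyl chamber
in `𝔞`, given by an element `H₀` of it. -/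
structure CartanData where
  /-- the maximal compact subgroup -/
  K : Subgroup G
  isCompact_K : IsCompact (K : Set G)
  maximal_K : ∀ K' : Subgroup G, IsCompact (K' : Set G) → K ≤ K' → K' = K
  /-- the Cartan involution -/
  θ : GroupLieAlgebra (𝓡 d) G ≃ₗ⁅ℝ⁆ GroupLieAlgebra (𝓡 d) G
  isCartanInvolution : IsCartanInvolution d G θ
  /-- the Lie algebra of `K` is the fixed algebra of `θ` -/
  lie_K : ∀ X : GroupLieAlgebra (𝓡 d) G, θ X = X ↔ ∀ t : ℝ, lieExp (t • X) ∈ K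
  /-- the maximal commutative subspace of `𝔭` -/
  𝔞 : Submodule ℝ (GroupLieAlgebra (𝓡 d) G)
  𝔞_le_𝔭 : ∀ X ∈ 𝔞, θ X = -X
  𝔞_comm : ∀ X ∈ 𝔞, ∀ Y ∈ 𝔞, ⁅X, Y⁆ = 0
  𝔞_maximal : ∀ 𝔟 : Submodule ℝ (GroupLieAlgebra (𝓡 d) G), (∀ X ∈ 𝔟, θ X = -X) →
    (∀ X ∈ 𝔟, ∀ Y ∈ 𝔟, ⁅X, Y⁆ = 0) → 𝔞 ≤ 𝔟 → 𝔟 = 𝔞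
  /-- an element of the positive Weyl chamber -/
  H₀ : 𝔞
  /-- `H₀` lies on no root hyperplane: `α H₀ ≠ 0` for every restricted root `α` -/
  regular_H₀ : ∀ α : Module.Dual ℝ 𝔞, α ≠ 0 →
    (∃ X : GroupLieAlgebra (𝓡 d) G, X ≠ 0 ∧
      ∀ H : 𝔞, ⁅(H : GroupLieAlgebra (𝓡 d) G), X⁆ = α H • X) → α H₀ ≠ 0

namespace CartanData

variable (D : CartanData d G)

/-- The simultaneous eigenspace `𝔤_α` of `ad 𝔞`. -/
noncomputable def rootSpace (α : Module.Dual ℝ D.𝔞) :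
    Submodule ℝ (GroupLieAlgebra (𝓡 d) G) where
  carrier := {X | ∀ H : D.𝔞, ⁅(H : GroupLieAlgebra (𝓡 d) G), X⁆ = α H • X}
  add_mem' := by
    intro X Y hX hY H
    rw [lie_add, hX H, hY H, smul_add]
  zero_mem' := by
    intro H
    rw [lie_zero, smul_zero]
  smul_mem' := by
    intro c X hX H
    rw [lie_smul, hX H, smul_comm]

/-- The set `Σ` of restricted roots. -/
def roots : Set (Module.Dual ℝ D.𝔞) := {α | α ≠ 0 ∧ D.rootSpace α ≠ ⊥}

/-- The set `Σ⁺` of roots that are positive on the Weyl chamber of `H₀`. -/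
def posRoots : Set (Module.Dual ℝ D.𝔞) := {α | α ∈ D.roots ∧ 0 < α D.H₀}

/-- `ρ`, half the sum of the positive roots, counted with multiplicity. -/
noncomputable def rho : Module.Dual ℝ D.𝔞 :=
  (1 / 2 : ℝ) • ∑ᶠ α ∈ D.posRoots, (Module.finrank ℝ (D.rootSpace α) : ℝ) • α

/-- `𝔫`, the sum of the root spaces of the positive roots. -/
noncomputable def 𝔫 : Submodule ℝ (GroupLieAlgebra (𝓡 d) G) :=
  ⨆ α ∈ D.posRoots, D.rootSpace α

/-- `N`, the (connected) subgroup of `G` generated by `exp 𝔫`. -/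
noncomputable def N : Subgroup G := Subgroup.closure {x | ∃ X ∈ D.𝔫, lieExp X = x}

/-- The Iwasawa projection: `x = k exp(H(x)) n` with `k ∈ K`, `H(x) ∈ 𝔞` and `n ∈ N`. -/
noncomputable def iwasawaH (x : G) : D.𝔞 :=
  open Classical in
  if h : ∃ H : D.𝔞, ∃ k ∈ D.K, ∃ n ∈ D.N,
      x = k * lieExp (H : GroupLieAlgebra (𝓡 d) G) * n then
    h.choose
  else 0

variable [MeasurableSpace G]

/-- Harish-Chandra's formula for the spherical function `φ_λ`, for real `λ`; `μK` stands for the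
normalised Haar measure of `K`. -/
noncomputable def spherical (μK : Measure D.K) (lam : Module.Dual ℝ D.𝔞) (x : G) : ℝ :=
  ∫ k : D.K, Real.exp (-((lam + D.rho) (D.iwasawaH (x⁻¹ * (k : G))))) ∂μK

end CartanData

end LieGroups

/-- The root-mean-square average of `u` over `K`, on the left and on the right. -/
noncomputable def rmsAverage {G : Type u} [Group G] [MeasurableSpace G] {K : Subgroup G}
    (μK : Measure K) (f : G → ℂ) (x : G) : ℝ :=
  Real.sqrt (∫ k : K, ∫ k' : K, ‖f ((k : G) * x * (k' : G))‖ ^ 2 ∂μK ∂μK)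

/-! ### Unitary representations -/

section Representations

/-- A (strongly) continuous unitary representation of `G` on `V`. -/
structure UnitaryRep (G : Type u) [Group G] [TopologicalSpace G]
    (V : Type v) [NormedAddCommGroup V] [InnerProductSpace ℂ V] where
  toHom : G →* (V ≃ₗᵢ[ℂ] V)
  continuous_apply : ∀ ξ : V, Continuous fun x : G => toHom x ξ

variable {G : Type u} [Group G] [TopologicalSpace G]

namespace UnitaryRep

variable {V : Type v} [NormedAddCommGroup V] [InnerProductSpace ℂ V]
  {W : Type w} [NormedAddCommGroup W] [InnerProductSpace ℂ W]

/-- The matrix coefficient `x ↦ ⟨π(x) ξ, η⟩`, linear in `ξ` and conjugate-linear in `η`. -/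
noncomputable def matrixCoeff (π : UnitaryRep G V) (ξ η : V) (x : G) : ℂ :=
  inner ℂ η (π.toHom x ξ)

/-- `σ` is weakly contained in `π`: every positive definite function associated to `σ` is a limit,
uniformly on compact sets, of finite sums of positive definite functions associated to `π`. -/
def WeaklyContained (σ : UnitaryRep G W) (π : UnitaryRep G V) : Prop :=
  ∀ ξ : W, ∀ Q : Set G, IsCompact Q → ∀ ε : ℝ, 0 < ε →
    ∃ (n : ℕ) (ζ : Fin n → V), ∀ x ∈ Q,
      ‖σ.matrixCoeff ξ ξ x - ∑ j, π.matrixCoeff (ζ j) (ζ j) x‖ < ε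

/-- `π` is irreducible: its space is nonzero and has no proper nonzero closed invariant
subspace. -/
def IsIrreducible (π : UnitaryRep G V) : Prop :=
  Nontrivial V ∧ ∀ S : Submodule ℂ V, IsClosed (S : Set V) →
    (∀ x : G, ∀ ξ ∈ S, π.toHom x ξ ∈ S) → S = ⊥ ∨ S = ⊤

end UnitaryRep

/-- A measurable field of (separable) Hilbert spaces over `X`, given by a fundamental sequence of
sections. -/
structure MeasurableHilbertField (X : Type w) [MeasurableSpace X] (h : X → Type v)
    [∀ x, NormedAddCommGroup (h x)] [∀ x, InnerProductSpace ℂ (h x)] where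
  e : ℕ → ∀ x, h x
  measurable_inner : ∀ m n, Measurable fun x => inner ℂ (e m x) (e n x)
  dense_span : ∀ x, Dense (Submodule.span ℂ (Set.range fun n => e n x) : Set (h x))

namespace MeasurableHilbertField

variable {X : Type w} [MeasurableSpace X] {h : X → Type v}
  [∀ x, NormedAddCommGroup (h x)] [∀ x, InnerProductSpace ℂ (h x)]

/-- Square-integrable measurable sections. -/
def IsL2Section (F : MeasurableHilbertField X h) (μ : Measure X) (s : ∀ x, h x) : Prop :=
  (∀ n, Measurable fun x => inner ℂ (F.e n x) (s x)) ∧ ∫⁻ x, ‖s x‖ₑ ^ 2 ∂μ < ⊤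

/-- `(σ x)` is a measurable field of unitary representations, and `π` is unitarily equivalent to
its direct integral `∫^⊕ σ x dμ(x)`. The map `U` picks, for each vector `ξ` of the space of `π`, a
square-integrable section in the class that corresponds to `ξ` under the unitary equivalence. -/
def IsDirectIntegral (F : MeasurableHilbertField X h) (μ : Measure X)
    (σ : ∀ x, UnitaryRep G (h x))
    {V : Type v} [NormedAddCommGroup V] [InnerProductSpace ℂ V] (π : UnitaryRep G V) : Prop :=
  (∀ (g : G) (m n : ℕ), Measurable fun x => inner ℂ (F.e m x) ((σ x).toHom g (F.e n x))) ∧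
  ∃ U : V → ∀ x, h x,
    (∀ ξ, F.IsL2Section μ (U ξ)) ∧
    (∀ ξ η, ∀ᵐ x ∂μ, U (ξ + η) x = U ξ x + U η x) ∧
    (∀ (c : ℂ) (ξ), ∀ᵐ x ∂μ, U (c • ξ) x = c • U ξ x) ∧
    (∀ ξ, ∫⁻ x, ‖U ξ x‖ₑ ^ 2 ∂μ = ‖ξ‖ₑ ^ 2) ∧
    (∀ s, F.IsL2Section μ s → ∃ ξ, ∀ᵐ x ∂μ, U ξ x = s x) ∧
    (∀ (g : G) (ξ), ∀ᵐ x ∂μ, U (π.toHom g ξ) x = (σ x).toHom g (U ξ x))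

end MeasurableHilbertField

end Representations

/-- The estimate `𝒜⟨π(·)ξ, η⟩ ≤ ‖ξ‖ ‖η‖ φ_λ` on `G`, for all vectors `ξ` and `η`. -/
def SphericalEstimate {d : ℕ} {G : Type u} [TopologicalSpace G]
    [ChartedSpace (EuclideanSpace ℝ (Fin d)) G] [Group G] [LieGroup (𝓡 d) ∞ G]
    [MeasurableSpace G] (D : CartanData d G) (μK : Measure D.K) (lam : Module.Dual ℝ D.𝔞)
    {V : Type v} [NormedAddCommGroup V] [InnerProductSpace ℂ V] (π : UnitaryRep G V) : Prop :=
  ∀ (ξ η : V) (x : G), rmsAverage μK (π.matrixCoeff ξ η) x ≤ ‖ξ‖ * ‖η‖ * D.spherical μK lam x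

/-!
Two facts carry the proof. The estimate passes to a representation `σ` that is weakly contained in
`π`, and almost every constituent of a direct integral is weakly contained in the direct integral.

For the first, the estimate passes from `π` to finite sums of its coefficients: if the
coefficients of `ζ j` and `η j` satisfy it, then their sum satisfies it with the constant `∑ ‖ζ j‖
‖η j‖`, since `𝒜` is a norm in `L²(K × K)` (`rmsAverage_eq_norm`), and Cauchy-Schwarz bounds this
constant by the product of the `ℓ²` norms of the two families. Weak containment only speaks of
diagonal coefficients `⟨σ(·) ξ, ξ⟩`. But the coefficients of `ξ` against `η = ∑ c g • σ(g) ξ`, and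
the number `‖η‖²`, are linear combinations of translates and values of the diagonal coefficient of
`ξ`, so they are approximated by the corresponding expressions for vectors of `π`
(`UnitaryRep.WeaklyContained.exists_orbitSum`). The estimate follows for `η` in the span of the
orbit of `ξ`, and then in its closure. For arbitrary `η` one replaces `η` by its orthogonal
projection to this closure, which leaves the coefficient unchanged and does not increase the norm
(`UnitaryRep.WeaklyContained.rmsAverage_matrixCoeff_le`).

For the second, let `s` be a measurable section. The diagonal coefficients of the vectors `s x` are
elements of `C(G, ℂ)`, which is second countable in the compact-open topology, so for almost every
`x` each neighbourhood of the coefficient of `s x` is met by the coefficients of the `s y` for a set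
of `y` of positive measure. Averaging over such a set gives a coefficient of the direct integral
that is close to that of `s x`
(`MeasurableHilbertField.IsDirectIntegral.ae_exists_approx`). Countably many sections have dense
values in every fibre, which suffices. Only the nonnegativity of the spherical function matters.
-/

/-! ### Connected locally compact groups -/

open Pointwise in
/-- A connected locally compact group is exhausted by the powers of a compact neighbourhood of the
identity: their union is a nonempty clopen set. -/
theorem sigmaCompactSpace_of_connected_group (G : Type*) [TopologicalSpace G] [Group G]
    [IsTopologicalGroup G] [LocallyCompactSpace G] [ConnectedSpace G] : SigmaCompactSpace G := by
  obtain ⟨C, hC, hC1⟩ := exists_compact_mem_nhds (1 : G)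
  set S : Set G := C ∪ C⁻¹ with hS
  have hScomp : IsCompact S := hC.union hC.inv
  have hpow : ∀ n : ℕ, IsCompact ((fun T : Set G => T * S)^[n] {1}) := by
    intro n
    induction n with
    | zero => exact isCompact_singleton
    | succ n ih =>
      rw [Function.iterate_succ_apply']
      exact ih.mul hScomp
  set T : Set G := ⋃ n, (fun T : Set G => T * S)^[n] {1} with hT
  have hTS : ∀ y ∈ T, ∀ s ∈ S, y * s ∈ T := by
    intro y hy s hs
    obtain ⟨n, hn⟩ := Set.mem_iUnion.1 hy
    refine Set.mem_iUnion.2 ⟨n + 1, ?_⟩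
    rw [Function.iterate_succ_apply']
    exact Set.mul_mem_mul hn hs
  have hnhds : ∀ x : G, {y | x⁻¹ * y ∈ C} ∈ nhds x := by
    intro x
    have : Filter.Tendsto (fun y => x⁻¹ * y) (nhds x) (nhds 1) := by
      have := (continuous_const_mul x⁻¹).tendsto x
      rwa [inv_mul_cancel] at this
    exact this hC1
  have hopen : IsOpen T := by
    refine isOpen_iff_mem_nhds.2 fun x hx => Filter.mem_of_superset (hnhds x) fun y hy => ?_
    simpa using hTS x hx _ (Or.inl hy)
  have hclosed : IsClosed T := by
    refine isClosed_of_closure_subset fun x hx => ?_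
    obtain ⟨y, hy, hyT⟩ := mem_closure_iff_nhds.1 hx _ (hnhds x)
    have : y⁻¹ * x ∈ C⁻¹ := by simpa using hy
    simpa using hTS y hyT _ (Or.inr this)
  have huniv : T = Set.univ :=
    IsClopen.eq_univ ⟨hclosed, hopen⟩ ⟨1, Set.mem_iUnion.2 ⟨0, rfl⟩⟩
  exact ⟨⟨fun n => (fun T : Set G => T * S)^[n] {1}, hpow, huniv⟩⟩

/-! ### The bi-`K`-average as an `L²` norm -/

section RmsAverage

variable {G : Type u} [TopologicalSpace G] [Group G] [IsTopologicalGroup G]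
  [MeasurableSpace G] [BorelSpace G]
  {K : Subgroup G} [CompactSpace K] [SecondCountableTopology K]
  (μK : Measure K) [IsProbabilityMeasure μK]

/-- The linear map that sends a continuous function `f` on `G` to the class of the function
`(k, k') ↦ f (k x k')` in `L²(K × K)`. -/
noncomputable def biTranslateLp (x : G) : C(G, ℂ) →ₗ[ℂ] Lp ℂ 2 (μK.prod μK) :=
  (ContinuousMap.toLp 2 (μK.prod μK) ℂ).toLinearMap ∘ₗ
    (ContinuousMap.compRightAlgHom ℂ ℂ
      (⟨fun p => (p.1 : G) * x * (p.2 : G), by fun_prop⟩ : C(K × K, G))).toLinearMap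

theorem rmsAverage_eq_norm (f : C(G, ℂ)) (x : G) :
    rmsAverage μK f x = ‖biTranslateLp μK x f‖ := by
  set F : C(K × K, ℂ) := f.comp ⟨fun p => (p.1 : G) * x * (p.2 : G), by fun_prop⟩ with hF
  have hb : biTranslateLp μK x f = ContinuousMap.toLp 2 (μK.prod μK) ℂ F := rfl
  have hint : Integrable (fun p : K × K => ‖F p‖ ^ 2) (μK.prod μK) :=
    (by fun_prop : Continuous fun p : K × K => ‖F p‖ ^ 2).integrable_of_hasCompactSupport
      (HasCompactSupport.of_compactSpace _)
  rw [hb, norm_eq_sqrt_re_inner (𝕜 := ℂ), ContinuousMap.inner_toLp, rmsAverage]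
  congr 1
  have : ∀ p : K × K, F p * (starRingEnd ℂ) (F p) = ((‖F p‖ ^ 2 : ℝ) : ℂ) := by
    intro p
    rw [RCLike.mul_conj]
    norm_cast
  simp only [this]
  rw [integral_complex_ofReal, integral_prod _ hint]
  rfl

theorem rmsAverage_sum_le {n : ℕ} (f : Fin n → C(G, ℂ)) (x : G) :
    rmsAverage μK (∑ j, f j : C(G, ℂ)) x ≤ ∑ j, rmsAverage μK (f j) x := by
  simp only [rmsAverage_eq_norm, map_sum]
  exact norm_sum_le _ _

theorem rmsAverage_le_add {f g : C(G, ℂ)} {x : G} {ε : ℝ}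
    (h : ∀ k k' : K, ‖f (k * x * k') - g (k * x * k')‖ ≤ ε) :
    rmsAverage μK f x ≤ rmsAverage μK g x + ε := by
  have hε : 0 ≤ ε := (norm_nonneg _).trans (h 1 1)
  have hd : rmsAverage μK (f - g : C(G, ℂ)) x ≤ ε := by
    rw [rmsAverage]
    refine Real.sqrt_le_iff.2 ⟨hε, ?_⟩
    have key : ∀ u : K → ℝ, (∀ k, 0 ≤ u k) → (∀ k, u k ≤ ε ^ 2) → ∫ k, u k ∂μK ≤ ε ^ 2 := by
      intro u hu0 hu
      have := integral_mono_of_nonneg (μ := μK) (Filter.Eventually.of_forall hu0)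
        (integrable_const (ε ^ 2)) (Filter.Eventually.of_forall hu)
      simpa using this
    refine key _ (fun k => integral_nonneg fun _ => by positivity) fun k => ?_
    refine key _ (fun _ => by positivity) fun k' => ?_
    exact pow_le_pow_left₀ (norm_nonneg _) (h k k') 2
  rw [rmsAverage_eq_norm, map_sub] at hd
  rw [rmsAverage_eq_norm, rmsAverage_eq_norm]
  linarith [norm_le_norm_add_norm_sub' (biTranslateLp μK x f) (biTranslateLp μK x g)]

end RmsAverage

/-! ### Matrix coefficients and weak containment -/

namespace UnitaryRep

variable {G : Type u} [Group G] [TopologicalSpace G]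
  {V : Type v} [NormedAddCommGroup V] [InnerProductSpace ℂ V]
  {W : Type w} [NormedAddCommGroup W] [InnerProductSpace ℂ W]

theorem continuous_matrixCoeff (π : UnitaryRep G V) (ξ η : V) :
    Continuous (π.matrixCoeff ξ η) :=
  continuous_const.inner (π.continuous_apply ξ)

/-- The matrix coefficient as an element of the space of continuous functions. -/
noncomputable def coeffMap (π : UnitaryRep G V) (ξ η : V) : C(G, ℂ) :=
  ⟨π.matrixCoeff ξ η, π.continuous_matrixCoeff ξ η⟩

@[simp]
theorem coe_coeffMap (π : UnitaryRep G V) (ξ η : V) :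
    ⇑(π.coeffMap ξ η) = π.matrixCoeff ξ η := rfl

theorem matrixCoeff_one (π : UnitaryRep G V) (ξ : V) :
    π.matrixCoeff ξ ξ 1 = ((‖ξ‖ ^ 2 : ℝ) : ℂ) := by
  rw [matrixCoeff, map_one]
  change inner ℂ ξ ξ = _
  rw [inner_self_eq_norm_sq_to_K]
  norm_cast

theorem inner_apply_apply (π : UnitaryRep G V) (g x : G) (ξ η : V) :
    inner ℂ (π.toHom g η) (π.toHom x ξ) = π.matrixCoeff ξ η (g⁻¹ * x) := by
  rw [matrixCoeff, ← (π.toHom g⁻¹).inner_map_map (π.toHom g η)]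
  change inner ℂ ((π.toHom g⁻¹ * π.toHom g) η) ((π.toHom g⁻¹ * π.toHom x) ξ) = _
  rw [← map_mul, ← map_mul, inv_mul_cancel, map_one]
  rfl

theorem norm_matrixCoeff_sub_le (π : UnitaryRep G V) (ξ η ξ' η' : V) (x : G) :
    ‖π.matrixCoeff ξ η x - π.matrixCoeff ξ' η' x‖ ≤ ‖ξ - ξ'‖ * ‖η‖ + ‖ξ'‖ * ‖η - η'‖ := by
  have : π.matrixCoeff ξ η x - π.matrixCoeff ξ' η' x =
      inner ℂ η (π.toHom x (ξ - ξ')) + inner ℂ (η - η') (π.toHom x ξ') := by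
    simp only [matrixCoeff, map_sub, inner_sub_left, inner_sub_right]
    ring
  rw [this]
  refine (norm_add_le _ _).trans (add_le_add ?_ ?_)
  · refine (norm_inner_le_norm _ _).trans_eq ?_
    rw [LinearIsometryEquiv.norm_map, mul_comm]
  · refine (norm_inner_le_norm _ _).trans_eq ?_
    rw [LinearIsometryEquiv.norm_map, mul_comm]

/-- `∑ g, c g • π(g) ξ`: the vector `ξ` moved by the element `c` of the group algebra. -/
noncomputable def orbitSum (π : UnitaryRep G V) (c : G →₀ ℂ) (ξ : V) : V :=
  ∑ g ∈ c.support, c g • π.toHom g ξ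

theorem matrixCoeff_orbitSum (π : UnitaryRep G V) (c : G →₀ ℂ) (ξ : V) (x : G) :
    π.matrixCoeff ξ (π.orbitSum c ξ) x =
      ∑ g ∈ c.support, (starRingEnd ℂ) (c g) * π.matrixCoeff ξ ξ (g⁻¹ * x) := by
  rw [matrixCoeff, orbitSum, sum_inner]
  refine Finset.sum_congr rfl fun g _ => ?_
  rw [inner_smul_left, inner_apply_apply]

theorem norm_sq_orbitSum (π : UnitaryRep G V) (c : G →₀ ℂ) (ξ : V) :
    ((‖π.orbitSum c ξ‖ ^ 2 : ℝ) : ℂ) =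
      ∑ x ∈ c.support, c x *
        ∑ g ∈ c.support, (starRingEnd ℂ) (c g) * π.matrixCoeff ξ ξ (g⁻¹ * x) := by
  have : ((‖π.orbitSum c ξ‖ ^ 2 : ℝ) : ℂ) = inner ℂ (π.orbitSum c ξ) (π.orbitSum c ξ) := by
    rw [inner_self_eq_norm_sq_to_K]
    norm_cast
  rw [this]
  conv_lhs => arg 3; rw [orbitSum]
  rw [inner_sum]
  refine Finset.sum_congr rfl fun x _ => ?_
  rw [inner_smul_right, ← matrixCoeff_orbitSum]
  rfl

/-- If the diagonal coefficient of `ξ` is close to a sum of diagonal coefficients of vectors `ζ j`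
of `π`, then the coefficients of `ξ` against a vector of the span of its orbit, and the norm of
that vector, are close to the corresponding sums for the `ζ j`. -/
theorem WeaklyContained.exists_orbitSum {σ : UnitaryRep G W} {π : UnitaryRep G V}
    [ContinuousMul G]
    (h : σ.WeaklyContained π) (ξ : W) (c : G →₀ ℂ) {Q : Set G} (hQ : IsCompact Q)
    {ε : ℝ} (hε : 0 < ε) :
    ∃ (n : ℕ) (ζ : Fin n → V),
      (∀ x ∈ Q, ‖σ.matrixCoeff ξ (σ.orbitSum c ξ) x -
        ∑ j, π.matrixCoeff (ζ j) (π.orbitSum c (ζ j)) x‖ ≤ ε) ∧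
      ∑ j, ‖ζ j‖ ^ 2 ≤ ‖ξ‖ ^ 2 + ε ∧
      ∑ j, ‖π.orbitSum c (ζ j)‖ ^ 2 ≤ ‖σ.orbitSum c ξ‖ ^ 2 + ε := by
  classical
  set M : ℝ := ∑ g ∈ c.support, ‖c g‖ with hM
  have hM0 : 0 ≤ M := Finset.sum_nonneg fun _ _ => norm_nonneg _
  -- `δ` is chosen so that `δ`, `M δ` and `M² δ` are all at most `ε`.
  set δ : ℝ := ε / (1 + M + M * M) with hδ
  have hden : 0 < 1 + M + M * M := by positivity
  have hδ0 : 0 < δ := div_pos hε hden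
  have hδε : (1 + M + M * M) * δ = ε := by rw [hδ]; field_simp
  set Q' : Set G := Q ∪ (c.support : Set G) with hQ'
  have hQ'c : IsCompact Q' := hQ.union c.support.finite_toSet.isCompact
  set Q₁ : Set G := {1} ∪ ⋃ g ∈ c.support, (fun x => g⁻¹ * x) '' Q' with hQ₁
  have hQ₁c : IsCompact Q₁ := isCompact_singleton.union
    (c.support.isCompact_biUnion fun g _ => hQ'c.image (continuous_const_mul g⁻¹))
  obtain ⟨n, ζ, hζ⟩ := h ξ Q₁ hQ₁c δ hδ0
  have hmem : ∀ g ∈ c.support, ∀ x ∈ Q', g⁻¹ * x ∈ Q₁ := fun g hg x hx =>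
    Or.inr (Set.mem_biUnion (by exact hg) ⟨x, hx, rfl⟩)
  have hclose : ∀ x ∈ Q', ‖(∑ g ∈ c.support, (starRingEnd ℂ) (c g) *
      σ.matrixCoeff ξ ξ (g⁻¹ * x)) - ∑ j, ∑ g ∈ c.support, (starRingEnd ℂ) (c g) *
        π.matrixCoeff (ζ j) (ζ j) (g⁻¹ * x)‖ ≤ M * δ := by
    intro x hx
    rw [Finset.sum_comm, ← Finset.sum_sub_distrib, hM, Finset.sum_mul]
    refine norm_sum_le_of_le _ fun g hg => ?_
    rw [← Finset.mul_sum, ← mul_sub, norm_mul, RCLike.norm_conj]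
    exact mul_le_mul_of_nonneg_left (hζ _ (hmem g hg x hx)).le (norm_nonneg _)
  refine ⟨n, ζ, fun x hx => ?_, ?_, ?_⟩
  · simp only [matrixCoeff_orbitSum]
    refine (hclose x (Or.inl hx)).trans ?_
    nlinarith
  · have h1 := hζ 1 (Or.inl rfl)
    simp only [matrixCoeff_one] at h1
    rw [← Complex.ofReal_sum, ← Complex.ofReal_sub, Complex.norm_real, Real.norm_eq_abs] at h1
    have := (abs_lt.1 h1).1
    nlinarith
  · have h2 : ‖((‖σ.orbitSum c ξ‖ ^ 2 : ℝ) : ℂ) -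
        ∑ j, ((‖π.orbitSum c (ζ j)‖ ^ 2 : ℝ) : ℂ)‖ ≤ M * (M * δ) := by
      simp only [norm_sq_orbitSum]
      rw [Finset.sum_comm, ← Finset.sum_sub_distrib]
      nth_rewrite 1 [hM]
      rw [Finset.sum_mul]
      refine norm_sum_le_of_le _ fun x hx => ?_
      rw [← Finset.mul_sum, ← mul_sub, norm_mul]
      exact mul_le_mul_of_nonneg_left (hclose x (Or.inr hx)) (norm_nonneg _)
    rw [← Complex.ofReal_sum, ← Complex.ofReal_sub, Complex.norm_real, Real.norm_eq_abs] at h2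
    have := (abs_le.1 h2).1
    nlinarith

theorem WeaklyContained.refl (π : UnitaryRep G V) : π.WeaklyContained π := by
  intro ξ Q _ ε hε
  exact ⟨1, fun _ => ξ, fun x _ => by simpa using hε⟩

theorem exists_orbitSum_eq_of_mem_span {σ : UnitaryRep G W} {ξ η : W}
    (h : η ∈ Submodule.span ℂ (Set.range fun g => σ.toHom g ξ)) :
    ∃ c : G →₀ ℂ, σ.orbitSum c ξ = η := by
  obtain ⟨c, hc⟩ := Finsupp.mem_span_range_iff_exists_finsupp.1 h
  exact ⟨c, hc⟩

section Estimate

variable [IsTopologicalGroup G] [MeasurableSpace G] [BorelSpace G]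
  {K : Subgroup G} [CompactSpace K] [SecondCountableTopology K]
  (μK : Measure K) [IsProbabilityMeasure μK]

/-- For fixed `ξ` and `x`, the set of the vectors `η` that satisfy the estimate is closed, because
the coefficient of `ξ` and `η` depends continuously on `η`, uniformly on `G`. -/
theorem rmsAverage_matrixCoeff_le_of_mem_closure (σ : UnitaryRep G W) {ξ η : W} {x : G} {C : ℝ}
    (hC : 0 ≤ C) {S : Set W}
    (hS : ∀ η' ∈ S, rmsAverage μK (σ.matrixCoeff ξ η') x ≤ ‖ξ‖ * ‖η'‖ * C) (hη : η ∈ closure S) :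
    rmsAverage μK (σ.matrixCoeff ξ η) x ≤ ‖ξ‖ * ‖η‖ * C := by
  refine le_of_forall_pos_le_add fun ε hε => ?_
  set A : ℝ := ‖ξ‖ * C + ‖ξ‖ + 1 with hA
  have hA0 : 0 < A := by positivity
  obtain ⟨η', hη', hd⟩ := Metric.mem_closure_iff.1 hη (ε / A) (div_pos hε hA0)
  rw [dist_eq_norm] at hd
  have h1 : rmsAverage μK (σ.coeffMap ξ η) x ≤
      rmsAverage μK (σ.coeffMap ξ η') x + ‖ξ‖ * ‖η - η'‖ :=
    rmsAverage_le_add μK fun k k' => by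
      simpa using σ.norm_matrixCoeff_sub_le ξ η ξ η' (k * x * k')
  have h2 := hS η' hη'
  have h3 : ‖η'‖ ≤ ‖η‖ + ‖η - η'‖ := by
    have := norm_sub_norm_le η' η
    rw [norm_sub_rev] at this
    linarith
  have h4 : A * ‖η - η'‖ ≤ ε := by
    have := (lt_div_iff₀ hA0).1 hd
    linarith
  have h5 : ‖ξ‖ * ‖η'‖ * C ≤ ‖ξ‖ * (‖η‖ + ‖η - η'‖) * C := by gcongr
  simp only [coe_coeffMap] at h1
  have h6 := norm_nonneg (η - η')
  rw [hA] at h4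
  nlinarith

/-- The estimate for a vector and an element of the span of its orbit. A sum of coefficients
of `π` satisfies the estimate with the `ℓ²` norms of the families of vectors, by the triangle
inequality and the Cauchy-Schwarz inequality. -/
theorem WeaklyContained.rmsAverage_orbitSum_le {σ : UnitaryRep G W} {π : UnitaryRep G V}
    (h : σ.WeaklyContained π) {x : G} {C : ℝ} (hC : 0 ≤ C)
    (hπ : ∀ ξ η : V, rmsAverage μK (π.matrixCoeff ξ η) x ≤ ‖ξ‖ * ‖η‖ * C)
    (ξ : W) (c : G →₀ ℂ) :
    rmsAverage μK (σ.matrixCoeff ξ (σ.orbitSum c ξ)) x ≤ ‖ξ‖ * ‖σ.orbitSum c ξ‖ * C := by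
  set η := σ.orbitSum c ξ with hη
  set Q : Set G := Set.range fun p : K × K => (p.1 : G) * x * (p.2 : G) with hQ
  have hQc : IsCompact Q := isCompact_range (by fun_prop)
  have hbound : ∀ ε : ℝ, 0 < ε → rmsAverage μK (σ.matrixCoeff ξ η) x ≤
      Real.sqrt (‖ξ‖ ^ 2 + ε) * Real.sqrt (‖η‖ ^ 2 + ε) * C + ε := by
    intro ε hε
    obtain ⟨n, ζ, h1, h2, h3⟩ := h.exists_orbitSum ξ c hQc hε
    have h4 : rmsAverage μK (σ.coeffMap ξ η) x ≤
        rmsAverage μK (∑ j, π.coeffMap (ζ j) (π.orbitSum c (ζ j)) : C(G, ℂ)) x + ε := by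
      refine rmsAverage_le_add μK fun k k' => ?_
      simpa using h1 _ ⟨(k, k'), rfl⟩
    refine h4.trans (add_le_add_left ?_ ε)
    calc _ ≤ ∑ j, rmsAverage μK (π.matrixCoeff (ζ j) (π.orbitSum c (ζ j))) x :=
          rmsAverage_sum_le μK (fun j => π.coeffMap (ζ j) (π.orbitSum c (ζ j))) x
      _ ≤ ∑ j, ‖ζ j‖ * ‖π.orbitSum c (ζ j)‖ * C := Finset.sum_le_sum fun j _ => hπ _ _
      _ = (∑ j, ‖ζ j‖ * ‖π.orbitSum c (ζ j)‖) * C := by rw [Finset.sum_mul]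
      _ ≤ Real.sqrt (∑ j, ‖ζ j‖ ^ 2) * Real.sqrt (∑ j, ‖π.orbitSum c (ζ j)‖ ^ 2) * C := by
          gcongr
          exact Real.sum_mul_le_sqrt_mul_sqrt _ _ _
      _ ≤ _ := by gcongr
  have hcont : Continuous fun ε : ℝ =>
      Real.sqrt (‖ξ‖ ^ 2 + ε) * Real.sqrt (‖η‖ ^ 2 + ε) * C + ε := by fun_prop
  have hlim := (hcont.tendsto 0).mono_left (nhdsWithin_le_nhds (s := Set.Ioi 0))
  simp only [add_zero, Real.sqrt_sq (norm_nonneg _)] at hlim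
  exact ge_of_tendsto hlim (Filter.eventually_of_mem self_mem_nhdsWithin hbound)

/-- The estimate passes to weakly contained representations. For given `ξ` and `η`, the vector `η`
may be replaced by its projection to the cyclic subspace of `ξ`. -/
theorem WeaklyContained.rmsAverage_matrixCoeff_le [CompleteSpace W]
    {σ : UnitaryRep G W} {π : UnitaryRep G V}
    (h : σ.WeaklyContained π) {x : G} {C : ℝ} (hC : 0 ≤ C)
    (hπ : ∀ ξ η : V, rmsAverage μK (π.matrixCoeff ξ η) x ≤ ‖ξ‖ * ‖η‖ * C) (ξ η : W) :
    rmsAverage μK (σ.matrixCoeff ξ η) x ≤ ‖ξ‖ * ‖η‖ * C := by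
  set S : Submodule ℂ W :=
    (Submodule.span ℂ (Set.range fun g => σ.toHom g ξ)).topologicalClosure with hS
  have : CompleteSpace S := (Submodule.isClosed_topologicalClosure _).completeSpace_coe
  set p : W := S.starProjection η with hp
  have hpS : p ∈ S := Submodule.starProjection_apply_mem S η
  have hpη : ‖p‖ ≤ ‖η‖ := Submodule.norm_starProjection_apply_le S η
  have heq : σ.matrixCoeff ξ η = σ.matrixCoeff ξ p := by
    funext y
    have hy : σ.toHom y ξ ∈ S :=
      Submodule.le_topologicalClosure _ (Submodule.subset_span ⟨y, rfl⟩)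
    have := Submodule.starProjection_inner_eq_zero (K := S) η _ hy
    rw [inner_sub_left, sub_eq_zero] at this
    exact this
  rw [heq]
  calc _ ≤ ‖ξ‖ * ‖p‖ * C := by
        refine σ.rmsAverage_matrixCoeff_le_of_mem_closure μK hC
          (S := Submodule.span ℂ (Set.range fun g => σ.toHom g ξ)) (fun η' hη' => ?_) hpS
        obtain ⟨c, rfl⟩ := exists_orbitSum_eq_of_mem_span hη'
        exact h.rmsAverage_orbitSum_le μK hC hπ ξ c
    _ ≤ _ := by gcongr

end Estimate

end UnitaryRep

/-! ### Direct integrals -/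

/-- Weak containment may be checked on a dense set of vectors. -/
theorem UnitaryRep.weaklyContained_of_dense {G : Type u} [Group G] [TopologicalSpace G]
    {V : Type v} [NormedAddCommGroup V] [InnerProductSpace ℂ V]
    {W : Type w} [NormedAddCommGroup W] [InnerProductSpace ℂ W]
    {σ : UnitaryRep G W} {π : UnitaryRep G V} {S : Set W} (hS : Dense S)
    (h : ∀ ξ ∈ S, ∀ Q : Set G, IsCompact Q → ∀ ε : ℝ, 0 < ε →
      ∃ (n : ℕ) (ζ : Fin n → V), ∀ x ∈ Q,
        ‖σ.matrixCoeff ξ ξ x - ∑ j, π.matrixCoeff (ζ j) (ζ j) x‖ < ε) :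
    σ.WeaklyContained π := by
  intro ξ Q hQ ε hε
  have hopen : IsOpen {ξ' : W | ‖ξ - ξ'‖ * ‖ξ‖ + ‖ξ'‖ * ‖ξ - ξ'‖ < ε / 2} :=
    isOpen_lt (by fun_prop) continuous_const
  obtain ⟨ξ', hξ', hξ'S⟩ := hS.exists_mem_open hopen ⟨ξ, by simpa using half_pos hε⟩
  obtain ⟨n, ζ, hζ⟩ := h ξ' hξ' Q hQ (ε / 2) (half_pos hε)
  refine ⟨n, ζ, fun x hx => ?_⟩
  have h1 := σ.norm_matrixCoeff_sub_le ξ ξ ξ' ξ' x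
  have h2 := hζ x hx
  have h3 := norm_sub_le_norm_sub_add_norm_sub (σ.matrixCoeff ξ ξ x) (σ.matrixCoeff ξ' ξ' x)
    (∑ j, π.matrixCoeff (ζ j) (ζ j) x)
  have h4 : ‖ξ - ξ'‖ * ‖ξ‖ + ‖ξ'‖ * ‖ξ - ξ'‖ < ε / 2 := hξ'S
  linarith

namespace MeasurableHilbertField

variable {G : Type u} [Group G] [TopologicalSpace G]
  {X : Type w} [MeasurableSpace X] {h : X → Type v}
  [∀ x, NormedAddCommGroup (h x)] [∀ x, InnerProductSpace ℂ (h x)]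
  {F : MeasurableHilbertField X h} {μ : Measure X} {σ : ∀ x, UnitaryRep G (h x)}
  {V : Type v} [NormedAddCommGroup V] [InnerProductSpace ℂ V] {π : UnitaryRep G V}

/-- Coefficients of the direct integral: cut off to a set of finite measure on which it is bounded,
a measurable section `s` is a vector of the direct integral, whose diagonal coefficient is the
integral of the diagonal coefficients of the `s x`. -/
theorem IsDirectIntegral.exists_matrixCoeff_eq_integral (hπ : F.IsDirectIntegral μ σ π)
    {s : ∀ x, h x} (hs : ∀ n, Measurable fun x => inner ℂ (F.e n x) (s x))
    (hsσ : ∀ g, Measurable fun x => (σ x).matrixCoeff (s x) (s x) g)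
    {E : Set X} (hE : MeasurableSet E) (hμE : μ E ≠ ⊤) {M : ℝ} (hM : ∀ x ∈ E, ‖s x‖ ^ 2 ≤ M) :
    ∃ ξ : V, ∀ g, IntegrableOn (fun x => (σ x).matrixCoeff (s x) (s x) g) E μ ∧
      π.matrixCoeff ξ ξ g = ∫ x in E, (σ x).matrixCoeff (s x) (s x) g ∂μ := by
  classical
  obtain ⟨-, U, -, hadd, hsmul, hnorm, hsurj, hequi⟩ := hπ
  have hint : ∀ g, IntegrableOn (fun x => (σ x).matrixCoeff (s x) (s x) g) E μ := fun g => by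
    refine Measure.integrableOn_of_bounded (M := M) hμE (hsσ g).aestronglyMeasurable ?_
    refine (ae_restrict_iff' hE).2 (Filter.Eventually.of_forall fun x hx => ?_)
    refine (norm_inner_le_norm _ _).trans ?_
    rw [LinearIsometryEquiv.norm_map, ← sq]
    exact hM x hx
  have hsq : ∀ x, ‖s x‖ ^ 2 = ((σ x).matrixCoeff (s x) (s x) 1).re := fun x => by
    rw [UnitaryRep.matrixCoeff_one, Complex.ofReal_re]
  have hsint : IntegrableOn (fun x => ‖s x‖ ^ 2) E μ := by
    simp only [hsq]
    exact (hint 1).re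
  set s' : ∀ x, h x := fun x => if x ∈ E then s x else 0 with hs'
  have hpE : (fun x => ‖s' x‖ ^ 2) = E.indicator fun x => ‖s x‖ ^ 2 := by
    funext x
    by_cases hx : x ∈ E <;> simp [hs', hx]
  have hqE : ∀ g, (fun x => (σ x).matrixCoeff (s' x) (s' x) g) =
      E.indicator fun x => (σ x).matrixCoeff (s x) (s x) g := fun g => by
    funext x
    by_cases hx : x ∈ E <;> simp [hs', hx, UnitaryRep.matrixCoeff]
  have hp : Integrable (fun x => ‖s' x‖ ^ 2) μ := hpE ▸ hsint.integrable_indicator hE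
  have hq : ∀ g, Integrable (fun x => (σ x).matrixCoeff (s' x) (s' x) g) μ := fun g =>
    (hqE g) ▸ (hint g).integrable_indicator hE
  have henorm : ∀ {H : Type v} [NormedAddCommGroup H] (y : H),
      ‖y‖ₑ ^ 2 = ENNReal.ofReal (‖y‖ ^ 2) := fun y => by
    rw [← ofReal_norm, ENNReal.ofReal_pow (norm_nonneg _)]
  have hL2 : F.IsL2Section μ s' := by
    refine ⟨fun n => ?_, ?_⟩
    · have : (fun x => inner ℂ (F.e n x) (s' x)) =
          E.indicator fun x => inner ℂ (F.e n x) (s x) := by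
        funext x
        by_cases hx : x ∈ E <;> simp [hs', hx]
      rw [this]
      exact (hs n).indicator hE
    · simp only [henorm]
      rw [← ofReal_integral_eq_lintegral_ofReal hp
        (Filter.Eventually.of_forall fun x => by positivity)]
      exact ENNReal.ofReal_lt_top
  obtain ⟨ξ, hξ⟩ := hsurj s' hL2
  -- Polarization: compare the norms of `c • ξ + π(g) ξ` on both sides for `c = 0, 1, i`.
  have hpol : ∀ (g : G) (c : ℂ), ‖c‖ ^ 2 * ‖ξ‖ ^ 2 +
      2 * ((starRingEnd ℂ) c * π.matrixCoeff ξ ξ g).re + ‖ξ‖ ^ 2 =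
      ‖c‖ ^ 2 * (∫ x, ‖s' x‖ ^ 2 ∂μ) +
      2 * ((starRingEnd ℂ) c * ∫ x, (σ x).matrixCoeff (s' x) (s' x) g ∂μ).re +
        ∫ x, ‖s' x‖ ^ 2 ∂μ := by
    intro g c
    have hexp : ∀ {H : Type v} [NormedAddCommGroup H] [InnerProductSpace ℂ H]
        (τ : UnitaryRep G H) (y : H), ‖c • y + τ.toHom g y‖ ^ 2 = ‖c‖ ^ 2 * ‖y‖ ^ 2 +
          2 * ((starRingEnd ℂ) c * τ.matrixCoeff y y g).re + ‖y‖ ^ 2 := by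
      intro H _ _ τ y
      rw [norm_add_sq (𝕜 := ℂ), inner_smul_left, norm_smul, mul_pow, LinearIsometryEquiv.norm_map]
      rfl
    have hU : ∀ᵐ x ∂μ, U (c • ξ + π.toHom g ξ) x = c • s' x + (σ x).toHom g (s' x) := by
      filter_upwards [hadd (c • ξ) (π.toHom g ξ), hsmul c ξ, hequi g ξ, hξ] with x h1 h2 h3 h4
      rw [h1, h2, h3, h4]
    have hre : Integrable
        (fun x => ((starRingEnd ℂ) c * (σ x).matrixCoeff (s' x) (s' x) g).re) μ :=
      ((hq g).const_mul _).re
    have hsum : Integrable (fun x => ‖c‖ ^ 2 * ‖s' x‖ ^ 2 +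
        2 * ((starRingEnd ℂ) c * (σ x).matrixCoeff (s' x) (s' x) g).re) μ :=
      (hp.const_mul _).add (hre.const_mul _)
    have hI : ∫ x, ‖c • s' x + (σ x).toHom g (s' x)‖ ^ 2 ∂μ =
        ‖c‖ ^ 2 * (∫ x, ‖s' x‖ ^ 2 ∂μ) +
        2 * ((starRingEnd ℂ) c * ∫ x, (σ x).matrixCoeff (s' x) (s' x) g ∂μ).re +
          ∫ x, ‖s' x‖ ^ 2 ∂μ := by
      simp only [hexp]
      rw [integral_add hsum hp,
        integral_add (hp.const_mul _) (hre.const_mul _), integral_const_mul, integral_const_mul,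
        ← integral_const_mul ((starRingEnd ℂ) c)]
      congr 3
      exact integral_re ((hq g).const_mul _)
    have hIint : Integrable (fun x => ‖c • s' x + (σ x).toHom g (s' x)‖ ^ 2) μ := by
      simp only [hexp]
      exact hsum.add hp
    have hn := hnorm (c • ξ + π.toHom g ξ)
    rw [lintegral_congr_ae (hU.mono fun x hx => by rw [hx])] at hn
    simp only [henorm] at hn
    rw [← ofReal_integral_eq_lintegral_ofReal hIint
        (Filter.Eventually.of_forall fun x => by positivity),
      ENNReal.ofReal_eq_ofReal_iff (integral_nonneg fun x => by positivity) (by positivity),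
      hI, hexp] at hn
    exact hn.symm
  refine ⟨ξ, fun g => ⟨hint g, ?_⟩⟩
  rw [← integral_indicator hE, ← hqE g]
  have h0 := hpol g 0
  have h1 := hpol g 1
  have hi := hpol g Complex.I
  simp only [norm_zero, map_zero, zero_mul, Complex.zero_re, mul_zero, ne_eq, OfNat.ofNat_ne_zero,
    not_false_eq_true, zero_pow, zero_add] at h0
  simp only [norm_one, map_one, one_mul, one_pow] at h1
  simp only [Complex.norm_I, Complex.conj_I, one_pow, one_mul, neg_mul, Complex.neg_re,
    Complex.I_mul_re, neg_neg] at hi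
  apply Complex.ext <;> linarith

/-- Almost every value of the measurable section `s` has its diagonal coefficient approximated by
those of the direct integral. Almost every `x` is such that the coefficients of `s y` and of `s x`
are close on `Q` for all `y` in a set `E` of positive measure, and then the average over `E` of the
former is a coefficient of the direct integral. -/
theorem IsDirectIntegral.ae_exists_approx [IsTopologicalGroup G] [LocallyCompactSpace G]
    [SecondCountableTopology G] [SigmaFinite μ] (hπ : F.IsDirectIntegral μ σ π)
    {s : ∀ x, h x} (hs : ∀ n, Measurable fun x => inner ℂ (F.e n x) (s x))
    (hsσ : ∀ g, Measurable fun x => (σ x).matrixCoeff (s x) (s x) g) :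
    ∀ᵐ x ∂μ, ∀ Q : Set G, IsCompact Q → ∀ ε : ℝ, 0 < ε →
      ∃ (n : ℕ) (ζ : Fin n → V), ∀ g ∈ Q,
        ‖(σ x).matrixCoeff (s x) (s x) g - ∑ j, π.matrixCoeff (ζ j) (ζ j) g‖ < ε := by
  set Φ : X → C(G, ℂ) := fun x => (σ x).coeffMap (s x) (s x) with hΦ
  set B := TopologicalSpace.countableBasis C(G, ℂ) with hB
  -- Almost every `Φ x` lies in the support of the image of `μ`.
  have hae : ∀ᵐ x ∂μ, ∀ b ∈ B, Φ x ∈ b → μ (Φ ⁻¹' b) ≠ 0 := by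
    refine (ae_ball_iff (TopologicalSpace.countable_countableBasis _)).2 fun b _ => ?_
    by_cases hb : μ (Φ ⁻¹' b) = 0
    · filter_upwards [measure_eq_zero_iff_ae_notMem.1 hb] with x hx hxb
      exact absurd hxb hx
    · exact Filter.Eventually.of_forall fun _ _ => hb
  filter_upwards [hae] with x₀ hx₀ Q hQ ε hε
  -- The identity is added to `Q` so that `‖s x‖` is bounded on `E₀`.
  set Q' : Set G := insert 1 Q with hQ'
  have hQ'c : IsCompact Q' := hQ.insert 1
  set E₀ : Set X := {x | ∀ g ∈ Q', ‖Φ x g - Φ x₀ g‖ ≤ ε / 2} with hE₀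
  have hE₀m : MeasurableSet E₀ := by
    obtain ⟨T, hTc, hTd⟩ := TopologicalSpace.exists_countable_dense Q'
    have : E₀ = ⋂ g ∈ T, {x | ‖Φ x (g : G) - Φ x₀ (g : G)‖ ≤ ε / 2} := by
      ext x
      simp only [Set.mem_iInter, Set.mem_ofPred_eq, hE₀]
      refine ⟨fun hx g _ => hx g g.2, fun hx g hg => ?_⟩
      have hcl : IsClosed {g : Q' | ‖Φ x (g : G) - Φ x₀ (g : G)‖ ≤ ε / 2} :=
        isClosed_le (by fun_prop) continuous_const
      have : (⟨g, hg⟩ : Q') ∈ closure T := hTd _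
      exact hcl.closure_subset_iff.2 (fun g hg => hx g hg) this
    rw [this]
    refine MeasurableSet.biInter hTc fun g _ => ?_
    exact measurableSet_le ((hsσ g).sub_const _).norm measurable_const
  have hE₀pos : 0 < μ E₀ := by
    have hnhds : {f : C(G, ℂ) | Set.MapsTo (f - Φ x₀) Q' (Metric.ball 0 (ε / 2))} ∈
        nhds (Φ x₀) := by
      have hopen : IsOpen {f : C(G, ℂ) | Set.MapsTo (f - Φ x₀) Q' (Metric.ball 0 (ε / 2))} :=
        (ContinuousMap.isOpen_setOfPred_mapsTo hQ'c Metric.isOpen_ball).preimage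
          (continuous_id.sub continuous_const)
      refine hopen.mem_nhds fun g _ => ?_
      simpa using hε
    obtain ⟨b, hb, hxb, hbsub⟩ :=
      (TopologicalSpace.isBasis_countableBasis C(G, ℂ)).mem_nhds_iff.1 hnhds
    refine (pos_iff_ne_zero.2 (hx₀ b hb hxb)).trans_le (measure_mono fun x hx g hg => ?_)
    have := hbsub hx hg
    rw [mem_ball_zero_iff] at this
    exact this.le
  obtain ⟨E, hEm, hEE₀, hEpos, hEtop⟩ := Measure.exists_subset_measure_lt_top hE₀m hE₀pos
  have hM : ∀ x ∈ E, ‖s x‖ ^ 2 ≤ ‖s x₀‖ ^ 2 + ε / 2 := by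
    intro x hx
    have h1 := hEE₀ hx 1 (Set.mem_insert _ _)
    simp only [hΦ, UnitaryRep.coe_coeffMap, UnitaryRep.matrixCoeff_one] at h1
    rw [← Complex.ofReal_sub, Complex.norm_real, Real.norm_eq_abs] at h1
    linarith [(abs_le.1 h1).2]
  obtain ⟨ξ, hξ⟩ := hπ.exists_matrixCoeff_eq_integral hs hsσ hEm hEtop.ne hM
  refine ⟨1, fun _ => ((Real.sqrt (μ.real E)⁻¹ : ℝ) : ℂ) • ξ, fun g hg => ?_⟩
  have havg : π.matrixCoeff (((Real.sqrt (μ.real E)⁻¹ : ℝ) : ℂ) • ξ)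
      (((Real.sqrt (μ.real E)⁻¹ : ℝ) : ℂ) • ξ) g =
      ⨍ x in E, (σ x).matrixCoeff (s x) (s x) g ∂μ := by
    rw [setAverage_eq, ← (hξ g).2, UnitaryRep.matrixCoeff, map_smul, inner_smul_left,
      inner_smul_right, ← mul_assoc, Complex.conj_ofReal, ← Complex.ofReal_mul,
      Real.mul_self_sqrt (by positivity), Complex.real_smul]
    rfl
  have hmem : ⨍ x in E, (σ x).matrixCoeff (s x) (s x) g ∂μ ∈
      Metric.closedBall ((σ x₀).matrixCoeff (s x₀) (s x₀) g) (ε / 2) := by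
    refine (convex_closedBall _ _).set_average_mem Metric.isClosed_closedBall hEpos.ne' hEtop.ne
      ((ae_restrict_iff' hEm).2 (Filter.Eventually.of_forall fun x hx => ?_)) (hξ g).1
    rw [mem_closedBall_iff_norm]
    exact hEE₀ hx g (Set.mem_insert_of_mem _ hg)
  rw [Fin.sum_univ_one, havg, norm_sub_rev]
  rw [mem_closedBall_iff_norm] at hmem
  linarith

/-- Almost every constituent of a direct integral is weakly contained in it. -/
theorem IsDirectIntegral.ae_weaklyContained [IsTopologicalGroup G] [LocallyCompactSpace G]
    [SecondCountableTopology G] [SigmaFinite μ] (hπ : F.IsDirectIntegral μ σ π) :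
    ∀ᵐ x ∂μ, (σ x).WeaklyContained π := by
  set s : ∀ n : ℕ, (Fin n → ℂ) → ∀ x, h x := fun n c x => ∑ i, c i • F.e i x with hsdef
  have hs : ∀ n c m, Measurable fun x => inner ℂ (F.e m x) (s n c x) := by
    intro n c m
    simp only [hsdef, inner_sum, inner_smul_right]
    exact Finset.measurable_sum _ fun i _ => (F.measurable_inner m i).const_mul _
  have hsσ : ∀ n c g, Measurable fun x => (σ x).matrixCoeff (s n c x) (s n c x) g := by
    intro n c g
    simp only [hsdef, UnitaryRep.matrixCoeff, map_sum, map_smul, inner_sum, sum_inner,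
      inner_smul_right, inner_smul_left]
    exact Finset.measurable_sum _ fun i _ => (Finset.measurable_sum _ fun j _ =>
      (hπ.1 g _ _).const_mul _).const_mul _
  have hae : ∀ᵐ x ∂μ, ∀ n k : ℕ, ∀ Q : Set G, IsCompact Q → ∀ ε : ℝ, 0 < ε →
      ∃ (m : ℕ) (ζ : Fin m → V), ∀ g ∈ Q,
        ‖(σ x).matrixCoeff (s n (TopologicalSpace.denseSeq _ k) x)
          (s n (TopologicalSpace.denseSeq _ k) x) g -
            ∑ j, π.matrixCoeff (ζ j) (ζ j) g‖ < ε :=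
    ae_all_iff.2 fun n => ae_all_iff.2 fun k => hπ.ae_exists_approx (hs n _) (hsσ n _)
  filter_upwards [hae] with x hx
  refine UnitaryRep.weaklyContained_of_dense
    (S := Set.range fun p : ℕ × ℕ => s p.1 (TopologicalSpace.denseSeq _ p.2) x) ?_ ?_
  · refine dense_closure.1 ((F.dense_span x).mono fun η hη => ?_)
    obtain ⟨c, rfl⟩ := Finsupp.mem_span_range_iff_exists_finsupp.1 hη
    obtain ⟨n, hn⟩ := c.support.exists_nat_subset_range
    have hsum : (c.sum fun i a => a • F.e i x) = s n (fun i => c i) x := by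
      rw [Finsupp.sum_of_support_subset c hn _ (by simp), Finset.sum_range]
    rw [hsum]
    have hcont : Continuous fun a : Fin n → ℂ => s n a x := by
      simp only [hsdef]
      fun_prop
    have hrange := hcont.range_subset_closure_image_dense
      (TopologicalSpace.denseRange_denseSeq (Fin n → ℂ)) ⟨fun i => c i, rfl⟩
    refine closure_mono ?_ hrange
    rintro _ ⟨_, ⟨k, rfl⟩, rfl⟩
    exact ⟨(n, k), rfl⟩
  · rintro _ ⟨p, rfl⟩
    exact hx p.1 p.2

end MeasurableHilbertField

/-! ### The spherical estimate -/

theorem theoremA {d : ℕ} {G : Type u} [TopologicalSpace G] [T2Space G]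
    [ChartedSpace (EuclideanSpace ℝ (Fin d)) G] [Group G] [LieGroup (𝓡 d) ∞ G]
    [ConnectedSpace G] [NoncompactSpace G] [Finite (Subgroup.center G)]
    [LieAlgebra.IsSemisimple ℝ (GroupLieAlgebra (𝓡 d) G)]
    [MeasurableSpace G] [BorelSpace G]
    (D : CartanData d G) (μK : Measure D.K) [μK.IsHaarMeasure] [IsProbabilityMeasure μK]
    (lam : Module.Dual ℝ D.𝔞)
    {V : Type v} [NormedAddCommGroup V] [InnerProductSpace ℂ V] [CompleteSpace V]
    (π : UnitaryRep G V) :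
    (SphericalEstimate D μK lam π ↔
      ∀ (W : Type v) [NormedAddCommGroup W] [InnerProductSpace ℂ W] [CompleteSpace W]
        (σ : UnitaryRep G W), σ.WeaklyContained π → SphericalEstimate D μK lam σ) ∧
    (SphericalEstimate D μK lam π →
      ∀ (X : Type w) [MeasurableSpace X] (μ : Measure X) [SigmaFinite μ] (h : X → Type v)
        [∀ x, NormedAddCommGroup (h x)] [∀ x, InnerProductSpace ℂ (h x)]
        [∀ x, CompleteSpace (h x)] (F : MeasurableHilbertField X h)
        (σ : ∀ x, UnitaryRep G (h x)), F.IsDirectIntegral μ σ π →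
        (∀ᵐ x ∂μ, (σ x).IsIrreducible) → ∀ᵐ x ∂μ, SphericalEstimate D μK lam (σ x)) := by
  have : IsTopologicalGroup G := topologicalGroup_of_lieGroup (𝓡 d) ∞
  have : LocallyCompactSpace G := ChartedSpace.locallyCompactSpace (EuclideanSpace ℝ (Fin d)) G
  have : SigmaCompactSpace G := sigmaCompactSpace_of_connected_group G
  have : SecondCountableTopology G :=
    ChartedSpace.secondCountable_of_sigmaCompact (EuclideanSpace ℝ (Fin d)) G
  have : CompactSpace D.K := isCompact_iff_compactSpace.1 D.isCompact_K
  have : SecondCountableTopology D.K :=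
    TopologicalSpace.Subtype.secondCountableTopology (D.K : Set G)
  have hweak : SphericalEstimate D μK lam π →
      ∀ (W : Type v) [NormedAddCommGroup W] [InnerProductSpace ℂ W] [CompleteSpace W]
        (σ : UnitaryRep G W), σ.WeaklyContained π → SphericalEstimate D μK lam σ := by
    intro hπ W _ _ _ σ hσ ξ η x
    exact hσ.rmsAverage_matrixCoeff_le μK (integral_nonneg fun _ => (Real.exp_pos _).le)
      (fun ξ η => hπ ξ η x) ξ η
  refine ⟨⟨hweak, fun hall => hall V π (UnitaryRep.WeaklyContained.refl π)⟩, ?_⟩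
  intro hπ X _ μ _ h _ _ _ F σ hF _
  filter_upwards [hF.ae_weaklyContained] with x hx
  exact hweak hπ (h x) (σ x) hx
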